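/- Let $K$ be a field, $P=K[x_1,\dots,x_n]$, let $I\subset P$ be an ideal such that $R=P/I$ has Krull dimension $0$ (in particular $I\neq P$ and $\dim_K R<\infty$), and let $I=\mathfrak Q_1\cap\dots\cap\mathfrak Q_s$ be its minimal primary decomposition, with $\mathfrak M_i=\operatorname{Rad}(\mathfrak Q_i)$ and $\ell_i=\dim_K(P/\mathfrak M_i)$. For $j\in\mathbb Z$ let $F_jR$ be the image in $R$ of $\{f\in P\mid f=0 \text{ or } \deg f\le j\}$, let $\operatorname{HF}^a_R(j)=\dim_K F_jR$ be the affine Hilbert function and $\Delta\operatorname{HF}^a_R(j)=\operatorname{HF}^a_R(j)-\operatorname{HF}^a_R(j-1)$, let $\operatorname{ri}(R)=\min\{i\in\mathbb Z\mid \operatorname{HF}^a_R(j)=\dim_K R\text{ for all }j\ge i\}$, and for $f\in R\setminus\{0\}$ let $\operatorname{ord}(f)$ be the integer $j$ with $f\in F_jR\setminus F_{j-1}R$. Let $\operatorname{gr}_{\mathcal F}(R)=\bigoplus_{j\in\mathbb Z}F_jR/F_{j-1}R$ be the associated graded ring. * A $0$-dimensional local ring $(A,\mathfrak m)$ is *Gorenstein*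 if $\dim_{A/\mathfrak m}\operatorname{Ann}_A(\mathfrak m)=1$. The ring $R$ is *locally Gorenstein* if $R/\mathfrak q$ is a Gorenstein local ring for every primary component $\mathfrak q$ of the zero ideal of $R$, and $R$ is a *strict Gorenstein ring* if $\operatorname{gr}_{\mathcal F}(R)$ is a local Gorenstein ring. * A *minimal $\mathfrak Q_i$-divisor* of $I$ is an ideal $J=\mathfrak Q_i'\cap\bigcap_{j\ne i}\mathfrak Q_j$, where $\mathfrak Q_i'$ is an ideal of $P$ with $\mathfrak Q_i\subsetneq\mathfrak Q_i'$ (the case $\mathfrak Q_i'=P$ is allowed), such that $\dim_K(J/I)=\ell_i$. The *separator degree* of $\mathfrak M_i/I$ is $\min_J\max\{\operatorname{ord}(f)\mid f\in (J/I)\setminus\{0\}\}$, where $J$ runs over all minimal $\mathfrak Q_i$-divisors of $I$. The ring $R$ has the *Cayley-Bacharach property (CBP)* if, for every $i=1,\dots,s$, the separator degree of $\mathfrak M_i/I$ equals $\operatorname{ri}(R)$. * The affine Hilbert function of $R$ is *symmetric* if $\Delta\operatorname{HF}^a_R(\operatorname{ri}(R)-j)=\Delta\operatorname{HF}^a_R(j)$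 for all $j\in\mathbb Z$. **Theorem 6.7 (First Characterization of Strict Gorenstein Rings).** The following conditions are equivalent: (a) $R$ is a strict Gorenstein ring. (b) $R$ has the CBP and a symmetric affine Hilbert function. If these conditions are satisfied, then $R$ is locally Gorenstein. -/

import Mathlib

open scoped DirectSum

noncomputable section

namespace AffineAlgebra

variable {K : Type*} [Field K] {n : ℕ}

/-! ### The degree filtration and the affine Hilbert function -/

/-- `F_i P`, the `K`-subspace of all polynomials all of whose terms have (total) degree `≤ i`,
for `i ∈ ℤ`. See `mem_polyFiltration` for the usual description. -/
def polyFiltration (K : Type*) [Field K] (n : ℕ) (i : ℤ) : Submodule K (MvPolynomial (Fin n) K) :=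
  MvPolynomial.restrictSupport K {m | ((m.degree : ℕ) : ℤ) ≤ i}

theorem mem_polyFiltration {i : ℤ} {f : MvPolynomial (Fin n) K} :
    f ∈ polyFiltration K n i ↔ f = 0 ∨ (f.totalDegree : ℤ) ≤ i := by
  rw [polyFiltration, MvPolynomial.mem_restrictSupport_iff]
  constructor
  · intro h
    by_cases hf : f = 0
    · exact Or.inl hf
    · right
      have hle : f.totalDegree ≤ i.toNat := by
        refine Finset.sup_le fun m hm => ?_
        have h1 : ((m.degree : ℕ) : ℤ) ≤ i := h (Finset.mem_coe.mpr hm)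
        have h2 : m.degree ≤ i.toNat := by omega
        exact h2
      obtain ⟨m, hm⟩ := MvPolynomial.support_nonempty.mpr hf
      have h1 : ((m.degree : ℕ) : ℤ) ≤ i := h (Finset.mem_coe.mpr hm)
      omega
  · rintro (rfl | h) m hm
    · simp at hm
    · have := MvPolynomial.le_totalDegree (Finset.mem_coe.mp hm)
      have h2 : m.degree ≤ f.totalDegree := this
      simp only [Set.mem_ofPred_eq]
      omega

variable (I : Ideal (MvPolynomial (Fin n) K))

/-- `F_i R`, the image of `F_i P` in `R = P/I`. -/
def degFiltration (i : ℤ) : Submodule K (MvPolynomial (Fin n) K ⧸ I) :=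
  (polyFiltration K n i).map (Ideal.Quotient.mkₐ K I).toLinearMap

theorem degFiltration_mono : Monotone (degFiltration I) := by
  intro i j hij
  refine Submodule.map_mono (MvPolynomial.restrictSupport_mono K ?_)
  intro m hm
  exact le_trans hm hij

theorem one_mem_degFiltration : (1 : MvPolynomial (Fin n) K ⧸ I) ∈ degFiltration I 0 :=
  ⟨1, mem_polyFiltration.mpr (Or.inr (by simp)), map_one (Ideal.Quotient.mkₐ K I)⟩

theorem mul_mem_degFiltration {i j : ℤ} {f g : MvPolynomial (Fin n) K ⧸ I}
    (hf : f ∈ degFiltration I i) (hg : g ∈ degFiltration I j) :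
    f * g ∈ degFiltration I (i + j) := by
  obtain ⟨f, hf, rfl⟩ := hf
  obtain ⟨g, hg, rfl⟩ := hg
  refine ⟨f * g, mem_polyFiltration.mpr ?_, map_mul (Ideal.Quotient.mkₐ K I) f g⟩
  rcases mem_polyFiltration.mp hf with rfl | hf
  · simp
  rcases mem_polyFiltration.mp hg with rfl | hg
  · simp
  right
  have := MvPolynomial.totalDegree_mul f g
  omega

/-- The affine Hilbert function `HF^a_R : ℤ → ℤ`, `i ↦ dim_K (F_i R)`. -/
def affineHilbert (i : ℤ) : ℤ := Module.finrank K (degFiltration I i)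

/-- The regularity index `ri(R) = min {i ∈ ℤ | HF^a_R(j) = dim_K R for all j ≥ i}`. -/
def regIndex : ℤ :=
  sInf {i : ℤ | ∀ j, i ≤ j →
    affineHilbert I j = Module.finrank K (MvPolynomial (Fin n) K ⧸ I)}

/-- The Castelnuovo function `Δ HF^a_R`. -/
def castelnuovo (i : ℤ) : ℤ := affineHilbert I i - affineHilbert I (i - 1)

/-- The affine Hilbert function is symmetric. -/
def HasSymmetricAffineHilbert : Prop :=
  ∀ i : ℤ, castelnuovo I (regIndex I - i) = castelnuovo I i

/-- The order of an element `f ≠ 0` of `R` with respect to the degree filtration. -/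
def filtOrder (f : MvPolynomial (Fin n) K ⧸ I) : ℤ :=
  sInf {i : ℤ | f ∈ degFiltration I i ∧ f ∉ degFiltration I (i - 1)}

/-! ### The Cayley-Bacharach property -/

open scoped Classical in
/-- `J` is a minimal `Q`-divisor of `I`, where `t` is the set of primary components of `I` and
`Q ∈ t`: one replaces `Q` by a strictly larger ideal `Q'` in the primary decomposition of `I`,
and `dim_K (J/I) = dim_K (P/Rad Q)`. Here `J/I` is the image of `J` in `P/I`.
If `I` is `0`-dimensional, `Rad Q` is the only prime ideal containing `Q`, so that `Q'` is either
contained in `Rad Q` or equal to `P`; by the dimension condition, the latter occurs if and only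
if `Q` is maximal. -/
def IsMinimalDivisor (t : Finset (Ideal (MvPolynomial (Fin n) K)))
    (Q J : Ideal (MvPolynomial (Fin n) K)) : Prop :=
  (∃ Q' : Ideal (MvPolynomial (Fin n) K), Q < Q' ∧ J = Q' ⊓ (t.erase Q).inf id) ∧
    Module.finrank K (J.map (Ideal.Quotient.mk I)) =
      Module.finrank K (MvPolynomial (Fin n) K ⧸ Q.radical)

/-- For an ideal `J̄ ≠ 0` of `R`, the number `ri(J̄) = max {ord(f) | f ∈ J̄ ∖ {0}}`. -/
def idealRegIndex (Jbar : Ideal (MvPolynomial (Fin n) K ⧸ I)) : ℤ :=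
  sSup {k : ℤ | ∃ f ∈ Jbar, f ≠ 0 ∧ k = filtOrder I f}

/-- The separator degree of the maximal ideal of `R` belonging to the primary component `Q ∈ t`
of `I`: the minimum of `ri(J̄)` over all minimal `Q`-divisors `J` of `I`. -/
def sepDegree (t : Finset (Ideal (MvPolynomial (Fin n) K)))
    (Q : Ideal (MvPolynomial (Fin n) K)) : ℤ :=
  sInf {k : ℤ | ∃ J, IsMinimalDivisor I t Q J ∧
    k = idealRegIndex I (J.map (Ideal.Quotient.mk I))}

open scoped Classical in
/-- The Cayley-Bacharach property of `R = P/I`: every maximal ideal of `R` has separator degree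
`ri(R)`. (The primary decomposition `t` of the `0`-dimensional ideal `I` is unique.) -/
def HasCBP : Prop :=
  ∀ t : Finset (Ideal (MvPolynomial (Fin n) K)), Submodule.IsMinimalPrimaryDecomposition I t →
    ∀ Q ∈ t, sepDegree I t Q = regIndex I

/-! ### The associated graded ring of the degree filtration -/

/-- The homogeneous component `F_i R / F_{i-1} R` of the associated graded ring. -/
def GrPiece (i : ℤ) : Type _ :=
  (degFiltration I i) ⧸ (degFiltration I (i - 1)).submoduleOf (degFiltration I i)

instance grPieceAddCommGroup (i : ℤ) : AddCommGroup (GrPiece I i) :=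
  inferInstanceAs (AddCommGroup
    ((degFiltration I i) ⧸ (degFiltration I (i - 1)).submoduleOf (degFiltration I i)))

instance grPieceModule (i : ℤ) : Module K (GrPiece I i) :=
  inferInstanceAs (Module K
    ((degFiltration I i) ⧸ (degFiltration I (i - 1)).submoduleOf (degFiltration I i)))

/-- The residue class map `F_i R → F_i R / F_{i-1} R`. -/
def GrPiece.mk (i : ℤ) : degFiltration I i →ₗ[K] GrPiece I i :=
  Submodule.mkQ ((degFiltration I (i - 1)).submoduleOf (degFiltration I i))

theorem GrPiece.mk_surjective (i : ℤ) : Function.Surjective (GrPiece.mk I i) :=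
  Submodule.mkQ_surjective _

theorem GrPiece.mk_eq_zero_iff {i : ℤ} (f : degFiltration I i) :
    GrPiece.mk I i f = 0 ↔ f.1 ∈ degFiltration I (i - 1) :=
  Submodule.Quotient.mk_eq_zero _

/-- The multiplication `F_i R × F_j R → F_{i+j} R / F_{i+j-1} R`, `(f, g) ↦ [f g]`. -/
def grMulAux (i j : ℤ) : degFiltration I i →ₗ[K] degFiltration I j →ₗ[K] GrPiece I (i + j) :=
  LinearMap.mk₂ K
    (fun f g => GrPiece.mk I (i + j) ⟨f.1 * g.1, mul_mem_degFiltration I f.2 g.2⟩)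
    (fun f f' g => by
      rw [← map_add]; congr 1; exact Subtype.ext (add_mul _ _ _))
    (fun c f g => by
      rw [← map_smul]; congr 1; exact Subtype.ext (smul_mul_assoc _ _ _))
    (fun f g g' => by
      rw [← map_add]; congr 1; exact Subtype.ext (mul_add _ _ _))
    (fun c f g => by
      rw [← map_smul]; congr 1; exact Subtype.ext (mul_smul_comm _ _ _))

/-- The multiplication of homogeneous elements, `[f] [g] = [f g]`; see `grMul_mk`. -/
def grMul (i j : ℤ) : GrPiece I i →ₗ[K] GrPiece I j →ₗ[K] GrPiece I (i + j) :=
  Submodule.liftQ ((degFiltration I (i - 1)).submoduleOf (degFiltration I i))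
    (LinearMap.flip (Submodule.liftQ ((degFiltration I (j - 1)).submoduleOf (degFiltration I j))
      (LinearMap.flip (grMulAux I i j)) (by
      intro g hg
      ext f
      refine (GrPiece.mk_eq_zero_iff I _).mpr ?_
      have := mul_mem_degFiltration I f.2 (Submodule.mem_comap.mp hg)
      rw [← add_sub_assoc] at this
      exact this)))
    (by
      intro f hf
      refine LinearMap.ext fun g => ?_
      obtain ⟨g, rfl⟩ := GrPiece.mk_surjective I j g
      refine (GrPiece.mk_eq_zero_iff I _).mpr ?_
      have := mul_mem_degFiltration I (Submodule.mem_comap.mp hf) g.2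
      rw [sub_add_eq_add_sub] at this
      exact this)

theorem grMul_mk {i j : ℤ} (f : degFiltration I i) (g : degFiltration I j) :
    grMul I i j (GrPiece.mk I i f) (GrPiece.mk I j g) =
      GrPiece.mk I (i + j) ⟨f.1 * g.1, mul_mem_degFiltration I f.2 g.2⟩ := rfl

theorem gradedMk_eq {i j : ℤ} (h : i = j) {f : degFiltration I i} {g : degFiltration I j}
    (hfg : f.1 = g.1) :
    GradedMonoid.mk (A := GrPiece I) i (GrPiece.mk I i f) =
      GradedMonoid.mk j (GrPiece.mk I j g) := by
  subst h
  rw [Subtype.ext hfg]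

instance grGMul : GradedMonoid.GMul (GrPiece I) where
  mul {i j} a b := grMul I i j a b

instance grGOne : GradedMonoid.GOne (GrPiece I) where
  one := GrPiece.mk I 0 ⟨1, one_mem_degFiltration I⟩

instance grCommRing : DirectSum.GCommRing (GrPiece I) where
  mul_zero a := map_zero _
  zero_mul {i j} b := LinearMap.map_zero₂ (grMul I i j) b
  mul_add a b c := map_add _ _ _
  add_mul {i j} a b c := LinearMap.map_add₂ (grMul I i j) a b c
  one_mul := by
    rintro ⟨i, a⟩
    obtain ⟨f, rfl⟩ := GrPiece.mk_surjective I _ a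
    exact gradedMk_eq I (zero_add i) (one_mul f.1)
  mul_one := by
    rintro ⟨i, a⟩
    obtain ⟨f, rfl⟩ := GrPiece.mk_surjective I _ a
    exact gradedMk_eq I (add_zero i) (mul_one f.1)
  mul_assoc := by
    rintro ⟨i, a⟩ ⟨j, b⟩ ⟨k, c⟩
    obtain ⟨f, rfl⟩ := GrPiece.mk_surjective I _ a
    obtain ⟨g, rfl⟩ := GrPiece.mk_surjective I _ b
    obtain ⟨h, rfl⟩ := GrPiece.mk_surjective I _ c
    exact gradedMk_eq I (add_assoc i j k) (mul_assoc f.1 g.1 h.1)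
  mul_comm := by
    rintro ⟨i, a⟩ ⟨j, b⟩
    obtain ⟨f, rfl⟩ := GrPiece.mk_surjective I _ a
    obtain ⟨g, rfl⟩ := GrPiece.mk_surjective I _ b
    exact gradedMk_eq I (add_comm i j) (mul_comm f.1 g.1)
  natCast m := m • GrPiece.mk I 0 ⟨1, one_mem_degFiltration I⟩
  natCast_zero := zero_smul _ _
  natCast_succ m := succ_nsmul _ _
  intCast m := m • GrPiece.mk I 0 ⟨1, one_mem_degFiltration I⟩
  intCast_ofNat m := natCast_zsmul _ _
  intCast_negSucc_ofNat m := negSucc_zsmul _ _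

/-- The associated graded ring `gr_F(R) = ⨁_{i ∈ ℤ} F_i R / F_{i-1} R`. -/
abbrev GrRing : Type _ := ⨁ i : ℤ, GrPiece I i

/-! ### Gorenstein rings -/

/-- `A` is a local ring, and its socle `Soc(A) = Ann_A(𝔪)` is a one-dimensional vector space over
the residue field `A/𝔪`. For a local ring of Krull dimension `0` (the only case in which it is
used below) this means that `A` is a local Gorenstein ring. -/
def IsZeroDimLocalGorenstein (A : Type*) [CommRing A] : Prop :=
  ∃ _ : IsLocalRing A,
    Module.finrank (A ⧸ IsLocalRing.maximalIdeal A)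
      (Submodule.torsionBySet A A (IsLocalRing.maximalIdeal A : Set A)) = 1

open scoped Classical in
/-- A `0`-dimensional ring `A` is locally Gorenstein if `A/𝔮` is a local Gorenstein ring for every
primary component `𝔮` of the zero ideal of `A`. -/
def IsLocallyGorenstein (A : Type*) [CommRing A] : Prop :=
  ∀ t : Finset (Ideal A), Submodule.IsMinimalPrimaryDecomposition (⊥ : Ideal A) t →
    ∀ q ∈ t, IsZeroDimLocalGorenstein (A ⧸ q)

/-- `R = P/I` is a strict Gorenstein ring if `gr_F(R)` is a local Gorenstein ring. -/
def IsStrictGorenstein : Prop := IsZeroDimLocalGorenstein (GrRing I)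

end AffineAlgebra

end

/-! ### Commutative algebra: socles, primary components, separators. -/

noncomputable section

namespace AffineAlgebra

/-! ### The socle of a local ring -/

/-! Put `r = ri(R)`. Everything is read off multiplication followed by `R → R / F_{r-1}`; the hinge
is `HasPerfectGradedPairing`: this quotient is a line, and every `x` of order `j` has a partner `y ∈
F_{r-j}` with `x y ∉ F_{r-1}`.

Strict Gorenstein is equivalent to this. The graded ring has only constants in degree `0` and
nothing outside degrees `0` to `r`, so it is local, its maximal ideal is its positive-degree part,
and its top component lies in the socle. A one-dimensional socle is therefore exactly the top
component, and any nonzero homogeneous element can be multiplied up to the top degree. Conversely,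
perfect pairings leave no room for socle elements below degree `r`.

CBP says that no nonzero ideal of `R` lies in `F_{r-1}` (`HasPerfectGradedPairing.hasCBP` uses one
direction, `HasCBP.exists_mul_notMem` proves the other). When `F_{r-1}` is the kernel of a linear
form `φ`, this is nondegeneracy of `φ(x y)`. Always `F_{j-1} ⊆ (F_{r-j})^⊥`; the graded pairings are
perfect when these inclusions are equalities, and comparing dimensions this is symmetry of the
Hilbert function.

Finally, a nondegenerate form `φ(x y)` makes `R` locally Gorenstein: the annihilator of a maximal
ideal is its orthogonal space, hence has the dimension of the residue field and is generated by one
separator. -/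

theorem isZeroDimLocalGorenstein_of_forall_eq_mul {A : Type*} [CommRing A] [IsLocalRing A] {s : A}
    (hs0 : s ≠ 0) (hs : ∀ a ∈ IsLocalRing.maximalIdeal A, a * s = 0)
    (hgen : ∀ x : A, (∀ a ∈ IsLocalRing.maximalIdeal A, a * x = 0) → ∃ c, x = c * s) :
    IsZeroDimLocalGorenstein A := by
  refine ⟨inferInstance, ?_⟩
  let _ := Ideal.Quotient.field (IsLocalRing.maximalIdeal A)
  have hmem : s ∈ Submodule.torsionBySet A A (IsLocalRing.maximalIdeal A : Set A) :=
    (Submodule.mem_torsionBySet_iff _ _).mpr fun a => hs a a.2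
  refine finrank_eq_one (⟨s, hmem⟩ : Submodule.torsionBySet A A _) ?_ ?_
  · intro h
    exact hs0 (congrArg Subtype.val h)
  · rintro ⟨x, hx⟩
    obtain ⟨c, hc⟩ := hgen x fun a ha => (Submodule.mem_torsionBySet_iff _ _).mp hx ⟨a, ha⟩
    exact ⟨Ideal.Quotient.mk _ c, Subtype.ext hc.symm⟩

theorem eq_mul_of_finrank_socle_eq_one {A : Type*} [CommRing A] [IsLocalRing A]
    (h : Module.finrank (A ⧸ IsLocalRing.maximalIdeal A)
      (Submodule.torsionBySet A A (IsLocalRing.maximalIdeal A : Set A)) = 1) {s x : A}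
    (hs0 : s ≠ 0) (hs : ∀ a ∈ IsLocalRing.maximalIdeal A, a * s = 0)
    (hx : ∀ a ∈ IsLocalRing.maximalIdeal A, a * x = 0) : ∃ c, x = c * s := by
  let _ := Ideal.Quotient.field (IsLocalRing.maximalIdeal A)
  have hmem : s ∈ Submodule.torsionBySet A A (IsLocalRing.maximalIdeal A : Set A) :=
    (Submodule.mem_torsionBySet_iff _ _).mpr fun a => hs a a.2
  have hxmem : x ∈ Submodule.torsionBySet A A (IsLocalRing.maximalIdeal A : Set A) :=
    (Submodule.mem_torsionBySet_iff _ _).mpr fun a => hx a a.2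
  have hne : (⟨s, hmem⟩ : Submodule.torsionBySet A A _) ≠ 0 := fun h =>
    hs0 (congrArg Subtype.val h)
  obtain ⟨c, hc⟩ := (finrank_eq_one_iff_of_nonzero' _ hne).mp h ⟨x, hxmem⟩
  obtain ⟨c, rfl⟩ := Ideal.Quotient.mk_surjective c
  exact ⟨c, (congrArg Subtype.val hc).symm⟩

/-! ### Minimal primary decompositions -/

section PrimaryDecomposition

variable {P : Type*} [CommRing P] {I : Ideal P} {t : Finset (Ideal P)} {Q : Ideal P}

theorem le_of_mem_decomposition (ht : Submodule.IsMinimalPrimaryDecomposition I t) (hQ : Q ∈ t) :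
    I ≤ Q := by
  rw [← ht.inf_eq]
  exact Finset.inf_le (f := id) hQ

open scoped Classical in
theorem inf_erase_inf_eq (ht : Submodule.IsMinimalPrimaryDecomposition I t) (hQ : Q ∈ t) :
    Q ⊓ (t.erase Q).inf id = I := by
  rw [← ht.inf_eq]
  conv_rhs => rw [← Finset.insert_erase hQ]
  rw [Finset.inf_insert, id]

theorem radical_isPrime_of_mem_decomposition
    (ht : Submodule.IsMinimalPrimaryDecomposition I t) (hQ : Q ∈ t) : Q.radical.IsPrime :=
  Ideal.isPrime_radical (ht.primary hQ)

/-- An element of `P ∖ I` which is multiplied into `I` by a maximal ideal `M` belongs to all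
primary components of `I` but the one with radical `M`. -/
theorem exists_component_of_annihilated_by_maximal
    (ht : Submodule.IsMinimalPrimaryDecomposition I t) {M : Ideal P} (hM : M.IsMaximal) {y : P}
    (hy : y ∉ I) (hMy : ∀ a ∈ M, a * y ∈ I) :
    ∃ Q ∈ t, Q.radical = M ∧ ∀ Q' ∈ t, Q' ≠ Q → y ∈ Q' := by
  have key : ∀ Q ∈ t, y ∉ Q → Q.radical = M := by
    intro Q hQ hyQ
    refine (hM.eq_of_le (radical_isPrime_of_mem_decomposition ht hQ).ne_top fun a ha => ?_).symm
    have h := le_of_mem_decomposition ht hQ (hMy a ha)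
    rw [mul_comm] at h
    exact ((Ideal.isPrimary_iff.mp (ht.primary hQ)).2 h).resolve_left hyQ
  have : ∃ Q ∈ t, y ∉ Q := by
    by_contra! h
    refine hy ?_
    rw [← ht.inf_eq, Submodule.mem_finsetInf]
    exact h
  obtain ⟨Q, hQ, hyQ⟩ := this
  refine ⟨Q, hQ, key Q hQ hyQ, fun Q' hQ' hne => ?_⟩
  by_contra hyQ'
  refine ht.distinct hQ' hQ hne ?_
  simp only [Submodule.colon_univ]
  rw [key Q hQ hyQ, key Q' hQ' hyQ']

open scoped Classical in
/-- Every primary component has a separator: an element of all other components outside `I` which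
is multiplied into `I` by the radical of the component. -/
theorem exists_separator [IsNoetherianRing P]
    (ht : Submodule.IsMinimalPrimaryDecomposition I t) (hQ : Q ∈ t) :
    ∃ y ∈ (t.erase Q).inf id, y ∉ Q ∧ ∀ a ∈ Q.radical, a * y ∈ I := by
  set N := (t.erase Q).inf id with hN
  -- Take the least such exponent: any element of the preceding power times `N` outside `Q` is a
  -- separator. Exponent `0` would make `Q` redundant.
  have hex : ∃ k, Q.radical ^ k * N ≤ Q := by
    obtain ⟨k, hk⟩ := Ideal.exists_radical_pow_le_of_fg Q (IsNoetherian.noetherian _)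
    exact ⟨k, Ideal.mul_le_left.trans hk⟩
  have hpos : Nat.find hex ≠ 0 := by
    intro h
    have := Nat.find_spec hex
    rw [h, pow_zero, one_mul] at this
    exact ht.minimal hQ this
  obtain ⟨k, hk⟩ := Nat.exists_eq_succ_of_ne_zero hpos
  have h1 := Nat.find_spec hex
  have h2 := Nat.find_min hex (m := k) (by omega)
  rw [hk] at h1
  obtain ⟨y, hy, hyQ⟩ := SetLike.not_le_iff_exists.mp h2
  have hyN : y ∈ N := Ideal.mul_le_right hy
  refine ⟨y, hyN, hyQ, fun a ha => ?_⟩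
  rw [← inf_erase_inf_eq ht hQ]
  refine ⟨h1 ?_, N.mul_mem_left a hyN⟩
  rw [pow_succ', mul_assoc]
  exact Ideal.mul_mem_mul ha hy

open scoped Classical in
-- The radicals of distinct components are distinct maximal ideals, so the components themselves are
-- comaximal.
theorem sup_inf_erase_eq_top (hmax : ∀ p : Ideal P, p.IsPrime → I ≤ p → p.IsMaximal)
    (ht : Submodule.IsMinimalPrimaryDecomposition I t) (hQ : Q ∈ t) :
    Q ⊔ (t.erase Q).inf id = ⊤ := by
  rw [Finset.inf_eq_iInf]
  refine Ideal.sup_iInf_eq_top fun Q' hQ' => ?_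
  obtain ⟨hne, hQ't⟩ := Finset.mem_erase.mp hQ'
  have hm : ∀ q ∈ t, q.radical.IsMaximal := fun q hq =>
    hmax _ (radical_isPrime_of_mem_decomposition ht hq)
      ((le_of_mem_decomposition ht hq).trans Ideal.le_radical)
  have hcop : IsCoprime Q.radical Q'.radical := by
    rw [Ideal.isCoprime_iff_sup_eq]
    refine Ideal.IsMaximal.coprime_of_ne (hm Q hQ) (hm Q' hQ't) fun h => ?_
    refine ht.distinct hQ hQ't hne.symm ?_
    simpa only [Submodule.colon_univ] using h
  have := Ideal.isCoprime_iff_sup_eq.mp hcop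
  by_contra h
  obtain ⟨m, hmm, hle⟩ := Ideal.exists_le_maximal _ h
  refine hmm.ne_top (top_le_iff.mp (this ▸ sup_le ?_ ?_))
  · exact hmm.isPrime.radical_le_iff.mpr (le_sup_left.trans hle)
  · exact hmm.isPrime.radical_le_iff.mpr (le_sup_right.trans hle)

end PrimaryDecomposition

/-- The quotient by an ideal with maximal radical is local. -/
theorem isLocalRing_quotient_of_radical_isMaximal {A : Type*} [CommRing A] {q : Ideal A}
    (hq : q.radical.IsMaximal) : IsLocalRing (A ⧸ q) := by
  have hne : q ≠ ⊤ := fun h => hq.ne_top (by rw [h, Ideal.radical_top])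
  refine IsLocalRing.of_unique_max_ideal
    ⟨q.radical.map (Ideal.Quotient.mk q), ?_, fun M hM => ?_⟩
  · refine Ideal.IsMaximal.map_of_surjective_of_ker_le Ideal.Quotient.mk_surjective ?_
    rw [Ideal.mk_ker]
    exact Ideal.le_radical
  · have hc : (M.comap (Ideal.Quotient.mk q)).IsMaximal :=
      Ideal.comap_isMaximal_of_surjective _ Ideal.Quotient.mk_surjective
    have hle : q.radical ≤ M.comap (Ideal.Quotient.mk q) := by
      refine hc.isPrime.radical_le_iff.mpr ?_
      intro x hx
      rw [Ideal.mem_comap, Ideal.Quotient.eq_zero_iff_mem.mpr hx]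
      exact M.zero_mem
    rw [hq.eq_of_le hc.ne_top hle, Ideal.map_comap_of_surjective _ Ideal.Quotient.mk_surjective]

theorem mk_mem_maximalIdeal_quotient {A : Type*} [CommRing A] {q : Ideal A} 
    [IsLocalRing (A ⧸ q)] {a : A} (ha : a ∈ q.radical) :
    Ideal.Quotient.mk q a ∈ IsLocalRing.maximalIdeal (A ⧸ q) := by
  obtain ⟨k, hk⟩ := ha
  refine (IsLocalRing.maximalIdeal.isMaximal (A ⧸ q)).isPrime.mem_of_pow_mem k ?_
  rw [← map_pow, Ideal.Quotient.eq_zero_iff_mem.mpr hk]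
  exact Ideal.zero_mem _

theorem mem_radical_of_mk_mem_maximalIdeal {A : Type*} [CommRing A] {q : Ideal A}
    (hq : q.radical.IsMaximal) [IsLocalRing (A ⧸ q)] {a : A}
    (ha : Ideal.Quotient.mk q a ∈ IsLocalRing.maximalIdeal (A ⧸ q)) : a ∈ q.radical := by
  have hc : ((IsLocalRing.maximalIdeal (A ⧸ q)).comap (Ideal.Quotient.mk q)).IsMaximal :=
    Ideal.comap_isMaximal_of_surjective _ Ideal.Quotient.mk_surjective
  rw [hq.eq_of_le hc.ne_top fun x hx => mk_mem_maximalIdeal_quotient hx]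
  exact ha

/-- The dimension of the principal ideal generated by `y` in `P/I`. -/
theorem finrank_map_sup_span_singleton {K P : Type*} [Field K] [CommRing P] [Algebra K P]
    {I M : Ideal P} {y : P} (hM : ∀ a, a ∈ M ↔ a * y ∈ I) :
    Module.finrank K ((I ⊔ Ideal.span {y}).map (Ideal.Quotient.mk I)) =
      Module.finrank K (P ⧸ M) := by
  set J := (I ⊔ Ideal.span {y}).map (Ideal.Quotient.mk I) with hJ
  have hyJ : Ideal.Quotient.mk I y ∈ J :=
    Ideal.mem_map_of_mem _ (Ideal.mem_sup_right (Ideal.mem_span_singleton_self y))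
  -- Multiplication by `y` maps `P` onto `J/I`, and its kernel is `M`.
  let f : P →ₗ[P] J := LinearMap.toSpanSingleton P J ⟨Ideal.Quotient.mk I y, hyJ⟩
  have hf : ∀ p, (f p).1 = Ideal.Quotient.mk I (p * y) := fun p => rfl
  have hker : LinearMap.ker f = M := by
    ext a
    rw [LinearMap.mem_ker, hM, ← Ideal.Quotient.eq_zero_iff_mem, ← hf]
    exact ⟨fun h => congrArg Subtype.val h, fun h => Subtype.ext h⟩
  have hsurj : Function.Surjective f := by
    rintro ⟨x, hx⟩
    obtain ⟨p, hp, rfl⟩ := (Ideal.mem_map_iff_of_surjective _ Ideal.Quotient.mk_surjective).mp hx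
    obtain ⟨i, hi, z, hz, rfl⟩ := Submodule.mem_sup.mp hp
    obtain ⟨c, rfl⟩ := Ideal.mem_span_singleton'.mp hz
    refine ⟨c, Subtype.ext ?_⟩
    rw [hf]
    simp [Ideal.Quotient.eq_zero_iff_mem.mpr hi]
  subst hker
  exact ((f.quotKerEquivOfSurjective hsurj).restrictScalars K).finrank_eq.symm

/-- Every element outside `I` has a multiple outside `I` that is multiplied into `I` by exactly a
prime ideal. -/
theorem exists_mul_colon_isPrime {P : Type*} [CommRing P] [IsNoetherianRing P] {I : Ideal P}
    {x : P} (hx : x ∉ I) :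
    ∃ c, c * x ∉ I ∧ ∃ M : Ideal P, M.IsPrime ∧ ∀ a, a ∈ M ↔ a * (c * x) ∈ I := by
  let f := LinearMap.toSpanSingleton P (P ⧸ I) (Ideal.Quotient.mk I x)
  have hf : ∀ p, f p = Ideal.Quotient.mk I (p * x) := fun p => rfl
  have : Nontrivial (LinearMap.range f) := by
    refine ⟨⟨⟨f 1, 1, rfl⟩, 0, fun h => hx ?_⟩⟩
    have := congrArg Subtype.val h
    rw [← Ideal.Quotient.eq_zero_iff_mem, ← one_mul x, ← hf]
    exact this
  -- An associated prime of the cyclic module generated by the class of `x` is the annihilator of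
  -- some multiple of that class.
  obtain ⟨M, hM⟩ := associatedPrimes.nonempty P (LinearMap.range f)
  obtain ⟨hMp, ⟨_, c, rfl⟩, hc⟩ := Submodule.isAssociatedPrime_iff.mp hM
  have hmem : ∀ a, a ∈ M ↔ a * (c * x) ∈ I := by
    intro a
    rw [hc, Submodule.mem_colon_singleton, Submodule.mem_bot, ← Ideal.Quotient.eq_zero_iff_mem,
      ← mul_assoc, ← hf, ← smul_eq_mul, map_smul]
    exact ⟨fun h => congrArg Subtype.val h, fun h => Subtype.ext h⟩
  refine ⟨c, fun h => hMp.ne_top ?_, M, hMp, hmem⟩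
  exact (Ideal.eq_top_iff_one _).mpr ((hmem 1).mpr (by rwa [one_mul]))

end AffineAlgebra

end

/-! ### The degree filtration, Hilbert function symmetry and orthogonality. -/

noncomputable section

namespace AffineAlgebra

variable {K : Type*} [Field K] {n : ℕ} (I : Ideal (MvPolynomial (Fin n) K))

/-! ### Properties of the degree filtration -/

theorem degFiltration_eq_bot {j : ℤ} (hj : j < 0) : degFiltration I j = ⊥ := by
  rw [eq_bot_iff]
  rintro _ ⟨f, hf, rfl⟩
  rcases mem_polyFiltration.mp hf with rfl | h
  · simp
  · omega

theorem algebraMap_mem_degFiltration_zero (c : K) :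
    algebraMap K (MvPolynomial (Fin n) K ⧸ I) c ∈ degFiltration I 0 := by
  rw [Algebra.algebraMap_eq_smul_one]
  exact Submodule.smul_mem _ c (one_mem_degFiltration I)

variable {I} in
theorem exists_eq_algebraMap_of_mem_degFiltration_zero {x : MvPolynomial (Fin n) K ⧸ I}
    (hx : x ∈ degFiltration I 0) : ∃ c : K, x = algebraMap K _ c := by
  obtain ⟨f, hf, rfl⟩ := hx
  rcases mem_polyFiltration.mp hf with rfl | h
  · exact ⟨0, by simp⟩
  · have h0 : f.totalDegree = 0 := by omega
    rw [MvPolynomial.totalDegree_eq_zero_iff_eq_C] at h0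
    refine ⟨f.coeff 0, ?_⟩
    rw [h0]
    simp only [MvPolynomial.coeff_C, if_true]
    rfl

theorem degFiltration_zero_eq_span :
    degFiltration I 0 = Submodule.span K {(1 : MvPolynomial (Fin n) K ⧸ I)} := by
  refine le_antisymm (fun x hx => ?_) ?_
  · obtain ⟨c, rfl⟩ := exists_eq_algebraMap_of_mem_degFiltration_zero hx
    rw [Algebra.algebraMap_eq_smul_one]
    exact Submodule.smul_mem _ _ (Submodule.mem_span_singleton_self 1)
  · rw [Submodule.span_singleton_le_iff_mem]
    exact one_mem_degFiltration I

theorem exists_mem_degFiltration_nat (x : MvPolynomial (Fin n) K ⧸ I) :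
    ∃ d : ℕ, x ∈ degFiltration I d := by
  obtain ⟨f, rfl⟩ := Ideal.Quotient.mk_surjective x
  exact ⟨f.totalDegree, f, mem_polyFiltration.mpr (Or.inr le_rfl), rfl⟩

theorem exists_degFiltration_eq_top [Module.Finite K (MvPolynomial (Fin n) K ⧸ I)] :
    ∃ d : ℕ, degFiltration I d = ⊤ := by
  obtain ⟨s, hs⟩ := Module.Finite.fg_top (R := K) (M := MvPolynomial (Fin n) K ⧸ I)
  choose d hd using exists_mem_degFiltration_nat I
  refine ⟨s.sup d, ?_⟩
  rw [eq_top_iff, ← hs, Submodule.span_le]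
  intro x hx
  exact degFiltration_mono I (by exact_mod_cast Finset.le_sup (f := d) hx) (hd x)

theorem affineHilbert_eq_finrank_iff [Module.Finite K (MvPolynomial (Fin n) K ⧸ I)] {j : ℤ} :
    affineHilbert I j = Module.finrank K (MvPolynomial (Fin n) K ⧸ I) ↔
      degFiltration I j = ⊤ := by
  rw [affineHilbert, Nat.cast_inj]
  refine ⟨Submodule.eq_top_of_finrank_eq, fun h => ?_⟩
  rw [h, finrank_top]

variable {I} in
theorem exists_order {x : MvPolynomial (Fin n) K ⧸ I} (hx : x ≠ 0) :
    ∃ j, x ∈ degFiltration I j ∧ x ∉ degFiltration I (j - 1) := by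
  have hb : ∀ z : ℤ, x ∈ degFiltration I z → 0 ≤ z := by
    intro z hz
    by_contra! h
    rw [degFiltration_eq_bot I h] at hz
    exact hx hz
  obtain ⟨d, hd⟩ := exists_mem_degFiltration_nat I x
  obtain ⟨j, hj, hmin⟩ := Int.exists_least_of_bdd ⟨0, hb⟩ ⟨d, hd⟩
  refine ⟨j, hj, fun h => ?_⟩
  have := hmin _ h
  omega

variable {I} in
theorem filtOrder_eq {x : MvPolynomial (Fin n) K ⧸ I} {j : ℤ} (hj : x ∈ degFiltration I j)
    (hj' : x ∉ degFiltration I (j - 1)) : filtOrder I x = j := by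
  have : {i : ℤ | x ∈ degFiltration I i ∧ x ∉ degFiltration I (i - 1)} = {j} := by
    ext i
    refine ⟨fun ⟨h, h'⟩ => ?_, fun h => ?_⟩
    · by_contra hne
      rcases lt_or_gt_of_ne hne with hlt | hlt
      · exact hj' (degFiltration_mono I (by omega) h)
      · exact h' (degFiltration_mono I (by omega) hj)
    · rw [Set.mem_singleton_iff.mp h]
      exact ⟨hj, hj'⟩
  rw [filtOrder, this, csInf_singleton]

variable {I} in
-- The hypothesis `J ≠ ⊥` excludes the default value `sSup ∅ = 0`.
theorem idealRegIndex_lt_regIndex {J : Ideal (MvPolynomial (Fin n) K ⧸ I)} (hJ : J ≠ ⊥)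
    (h : ∀ x ∈ J, x ∈ degFiltration I (regIndex I - 1)) : idealRegIndex I J < regIndex I := by
  suffices idealRegIndex I J ≤ regIndex I - 1 by omega
  obtain ⟨x, hxJ, hx⟩ := Submodule.exists_mem_ne_zero_of_ne_bot hJ
  refine csSup_le ⟨_, x, hxJ, hx, rfl⟩ ?_
  rintro k ⟨f, hfJ, hf, rfl⟩
  obtain ⟨j, hj, hj'⟩ := exists_order hf
  rw [filtOrder_eq hj hj']
  by_contra! hlt
  exact hj' (degFiltration_mono I (by omega) (h f hfJ))

theorem affineHilbert_of_neg {j : ℤ} (hj : j < 0) : affineHilbert I j = 0 := by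
  rw [affineHilbert, degFiltration_eq_bot I hj, finrank_bot, Nat.cast_zero]

theorem affineHilbert_zero [Nontrivial (MvPolynomial (Fin n) K ⧸ I)] : affineHilbert I 0 = 1 := by
  rw [affineHilbert, degFiltration_zero_eq_span, finrank_span_singleton one_ne_zero, Nat.cast_one]

section Artinian

variable [Module.Finite K (MvPolynomial (Fin n) K ⧸ I)] [Nontrivial (MvPolynomial (Fin n) K ⧸ I)]

/-- By monotonicity, the quantifier over all larger indices in `regIndex` is redundant. -/
theorem degFiltration_eq_top_iff {j : ℤ} : degFiltration I j = ⊤ ↔ regIndex I ≤ j := by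
  have hset : {i : ℤ | ∀ j, i ≤ j →
      affineHilbert I j = Module.finrank K (MvPolynomial (Fin n) K ⧸ I)} =
      {i : ℤ | degFiltration I i = ⊤} := by
    ext i
    simp only [affineHilbert_eq_finrank_iff, Set.mem_ofPred_eq]
    exact ⟨fun h => h i le_rfl, fun h j hij => top_le_iff.mp (h ▸ degFiltration_mono I hij)⟩
  have hne : {i : ℤ | degFiltration I i = ⊤}.Nonempty :=
    (exists_degFiltration_eq_top I).imp' _ fun _ h => h
  have hbdd : BddBelow {i : ℤ | degFiltration I i = ⊤} := by
    refine ⟨0, fun i hi => ?_⟩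
    by_contra! h
    exact bot_ne_top ((degFiltration_eq_bot I h).symm.trans hi)
  rw [regIndex, hset]
  refine ⟨fun h => csInf_le hbdd h, fun h => ?_⟩
  exact top_le_iff.mp ((Int.csInf_mem hne hbdd).symm.le.trans (degFiltration_mono I h))

theorem degFiltration_regIndex : degFiltration I (regIndex I) = ⊤ :=
  (degFiltration_eq_top_iff I).mpr le_rfl

theorem mem_degFiltration_of_regIndex_le {j : ℤ} (hj : regIndex I ≤ j)
    (x : MvPolynomial (Fin n) K ⧸ I) : x ∈ degFiltration I j := by
  rw [(degFiltration_eq_top_iff I).mpr hj]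
  trivial

theorem exists_notMem_degFiltration : ∃ x, x ∉ degFiltration I (regIndex I - 1) := by
  by_contra! h
  have := (degFiltration_eq_top_iff I).mp (eq_top_iff.mpr fun x _ => h x)
  omega

variable {I} in
theorem filtOrder_le_regIndex {x : MvPolynomial (Fin n) K ⧸ I} (hx : x ≠ 0) :
    filtOrder I x ≤ regIndex I := by
  obtain ⟨j, hj, hj'⟩ := exists_order hx
  rw [filtOrder_eq hj hj']
  by_contra! h
  exact hj' (mem_degFiltration_of_regIndex_le I (by omega) x)

variable {I} in
theorem filtOrder_eq_regIndex {x : MvPolynomial (Fin n) K ⧸ I}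
    (hx : x ∉ degFiltration I (regIndex I - 1)) : filtOrder I x = regIndex I :=
  filtOrder_eq (mem_degFiltration_of_regIndex_le I le_rfl x) hx

variable {I} in
theorem idealRegIndex_eq_regIndex {J : Ideal (MvPolynomial (Fin n) K ⧸ I)}
    {x : MvPolynomial (Fin n) K ⧸ I} (hxJ : x ∈ J) (hx : x ∉ degFiltration I (regIndex I - 1)) :
    idealRegIndex I J = regIndex I := by
  have hx0 : x ≠ 0 := fun h => hx (h ▸ Submodule.zero_mem _)
  refine IsGreatest.csSup_eq ⟨⟨x, hxJ, hx0, (filtOrder_eq_regIndex hx).symm⟩, ?_⟩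
  rintro k ⟨f, -, hf, rfl⟩
  exact filtOrder_le_regIndex hf

variable {I} in
-- Supplies the lower bound that makes the infimum in `sepDegree` meaningful.
theorem idealRegIndex_nonneg {J : Ideal (MvPolynomial (Fin n) K ⧸ I)}
    (hJ : J ≠ ⊥) : 0 ≤ idealRegIndex I J := by
  obtain ⟨x, hxJ, hx⟩ := Submodule.exists_mem_ne_zero_of_ne_bot hJ
  refine le_csSup_of_le ⟨regIndex I, ?_⟩ ⟨x, hxJ, hx, rfl⟩ ?_
  · rintro k ⟨f, -, hf, rfl⟩
    exact filtOrder_le_regIndex hf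
  · obtain ⟨j, hj, hj'⟩ := exists_order hx
    rw [filtOrder_eq hj hj']
    by_contra! h
    rw [degFiltration_eq_bot I h] at hj
    exact hx hj

/-! ### The affine Hilbert function -/

/-- The affine Hilbert function is symmetric if and only if
`HF^a_R(j) + HF^a_R(ri(R) - 1 - j) = dim_K R` for all `j`. -/
theorem hasSymmetricAffineHilbert_iff : HasSymmetricAffineHilbert I ↔
    ∀ j, affineHilbert I j + affineHilbert I (regIndex I - 1 - j) =
      Module.finrank K (MvPolynomial (Fin n) K ⧸ I) := by
  constructor
  · intro h j
    -- Symmetry at `i` says that the sum is the same at `i` and `i - 1`; at `-1` it is `0 + dim R`.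
    have hstep : ∀ i, affineHilbert I i + affineHilbert I (regIndex I - 1 - i) =
        affineHilbert I (i - 1) + affineHilbert I (regIndex I - 1 - (i - 1)) := by
      intro i
      have := h i
      rw [castelnuovo, castelnuovo] at this
      rw [show regIndex I - 1 - (i - 1) = regIndex I - i by ring,
        show regIndex I - 1 - i = regIndex I - i - 1 by ring]
      linarith
    have hbase : affineHilbert I (-1) + affineHilbert I (regIndex I - 1 - (-1)) =
        Module.finrank K (MvPolynomial (Fin n) K ⧸ I) := by
      rw [affineHilbert_of_neg I (by norm_num), zero_add, affineHilbert_eq_finrank_iff,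
        degFiltration_eq_top_iff]
      omega
    induction j using Int.inductionOn' (b := -1) with
    | zero => exact hbase
    | succ k _ ih =>
      rw [hstep, add_sub_cancel_right]
      exact ih
    | pred k _ ih =>
      rw [← hstep]
      exact ih
  · intro h i
    have h1 := h i
    have h2 := h (i - 1)
    rw [show regIndex I - 1 - (i - 1) = regIndex I - i by ring] at h2
    rw [show regIndex I - 1 - i = regIndex I - i - 1 by ring] at h1
    rw [castelnuovo, castelnuovo]
    linarith

end Artinian

/-! ### The pairing given by the last step of the degree filtration -/

/-- The multiplication followed by `R → R / F_{ri(R)-1} R` gives perfect pairings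
between the homogeneous components of the associated graded ring in complementary degrees. -/
structure HasPerfectGradedPairing : Prop where
  finrank_quotient :
    Module.finrank K ((MvPolynomial (Fin n) K ⧸ I) ⧸ degFiltration I (regIndex I - 1)) = 1
  exists_mul_notMem : ∀ (j : ℤ) (x : MvPolynomial (Fin n) K ⧸ I), x ∈ degFiltration I j →
    x ∉ degFiltration I (j - 1) →
    ∃ y ∈ degFiltration I (regIndex I - j), x * y ∉ degFiltration I (regIndex I - 1)

variable {I} in
-- Forgetting the degree of the partner: `F_{ri(R)-1}` contains no nonzero ideal.
theorem HasPerfectGradedPairing.exists_mul_notMem_of_ne_zero (h : HasPerfectGradedPairing I)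
    {x : MvPolynomial (Fin n) K ⧸ I} (hx : x ≠ 0) :
    ∃ y, x * y ∉ degFiltration I (regIndex I - 1) := by
  obtain ⟨j, hj, hj'⟩ := exists_order hx
  obtain ⟨y, -, hy⟩ := h.exists_mul_notMem j x hj hj'
  exact ⟨y, hy⟩

/-- A subspace of codimension one is the kernel of a linear form. -/
theorem exists_linearForm_of_finrank_quotient_eq_one {V : Type*} [AddCommGroup V] [Module K V]
    {W : Submodule K V} (h : Module.finrank K (V ⧸ W) = 1) :
    ∃ φ : V →ₗ[K] K, ∀ x, φ x = 0 ↔ x ∈ W := by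
  have : Module.Finite K (V ⧸ W) := Module.finite_of_finrank_pos (by omega)
  let e : (V ⧸ W) ≃ₗ[K] K := LinearEquiv.ofFinrankEq _ _ (by rw [h, Module.finrank_self])
  refine ⟨e.toLinearMap ∘ₗ W.mkQ, fun x => ?_⟩
  simp

/-- For a linear form `φ` such that `(x, y) ↦ φ(x y)` is nondegenerate, the dimension of the
orthogonal space of a subspace. -/
theorem finrank_add_finrank_mul_orthogonal {R : Type*} [CommRing R] [Algebra K R]
    [Module.Finite K R] {φ : R →ₗ[K] K} (hφ : ∀ x, x ≠ 0 → ∃ y, φ (x * y) ≠ 0)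
    (W W' : Submodule K R) (hW' : ∀ x, x ∈ W' ↔ ∀ y ∈ W, φ (x * y) = 0) :
    Module.finrank K W + Module.finrank K W' = Module.finrank K R := by
  let B : LinearMap.BilinForm K R := (LinearMap.mul K R).compr₂ φ
  have hB : ∀ x y, B x y = φ (x * y) := fun x y => rfl
  have hnd : B.Nondegenerate := by
    refine ⟨fun x hx => ?_, fun x hx => ?_⟩
    · by_contra h
      obtain ⟨y, hy⟩ := hφ x h
      exact hy (hx y)
    · by_contra h
      obtain ⟨y, hy⟩ := hφ x h
      refine hy ?_
      rw [mul_comm]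
      exact hx y
  have horth : W' = B.orthogonal W := by
    ext x
    rw [hW', LinearMap.BilinForm.mem_orthogonal_iff]
    refine forall₂_congr fun y _ => ?_
    rw [mul_comm]
    exact Iff.rfl
  rw [horth, LinearMap.BilinForm.finrank_orthogonal hnd]
  have := Submodule.finrank_le W
  omega

section Artinian

variable [Module.Finite K (MvPolynomial (Fin n) K ⧸ I)] [Nontrivial (MvPolynomial (Fin n) K ⧸ I)]

variable {I} in
-- For a form with kernel `F_{ri(R)-1}`, the orthogonal space of `F_j` is exactly `F_{ri(R)-1-j}`,
-- so the two dimensions add up to `dim R`.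
theorem HasPerfectGradedPairing.hasSymmetricAffineHilbert (h : HasPerfectGradedPairing I) :
    HasSymmetricAffineHilbert I := by
  rw [hasSymmetricAffineHilbert_iff]
  intro j
  obtain ⟨φ, hφ⟩ := exists_linearForm_of_finrank_quotient_eq_one h.finrank_quotient
  have hnd : ∀ x, x ≠ 0 → ∃ y, φ (x * y) ≠ 0 := fun x hx =>
    (h.exists_mul_notMem_of_ne_zero hx).imp fun y hy => (hφ _).not.mpr hy
  rw [affineHilbert, affineHilbert, ← Nat.cast_add,
    finrank_add_finrank_mul_orthogonal hnd _ (degFiltration I (regIndex I - 1 - j))]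
  intro x
  constructor
  · intro hx y hy
    rw [hφ, show regIndex I - 1 = (regIndex I - 1 - j) + j by ring]
    exact mul_mem_degFiltration I hx hy
  · intro hx
    by_cases hx0 : x = 0
    · rw [hx0]
      exact Submodule.zero_mem _
    obtain ⟨k, hk, hk'⟩ := exists_order hx0
    refine degFiltration_mono I ?_ hk
    -- If the order `k` exceeds `ri(R)-1-j`, the partner of `x` lies in `F_{ri(R)-k} ⊆ F_j`, against
    -- orthogonality.
    by_contra! hlt
    obtain ⟨y, hy, hxy⟩ := h.exists_mul_notMem k x hk hk'
    exact hxy ((hφ _).mp (hx y (degFiltration_mono I (by omega) hy)))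

variable {I} in
-- Symmetry gives `F_{j-1}` the dimension of the orthogonal space of `F_{ri(R)-j}`, which contains
-- it. So they agree, and an element outside `F_{j-1}` pairs nontrivially with `F_{ri(R)-j}`.
theorem HasSymmetricAffineHilbert.hasPerfectGradedPairing (h : HasSymmetricAffineHilbert I)
    (hnd : ∀ x, x ≠ 0 → ∃ y, x * y ∉ degFiltration I (regIndex I - 1)) :
    HasPerfectGradedPairing I := by
  rw [hasSymmetricAffineHilbert_iff] at h
  have hq : Module.finrank K
      ((MvPolynomial (Fin n) K ⧸ I) ⧸ degFiltration I (regIndex I - 1)) = 1 := by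
    -- Since `F_0` is the line of constants, symmetry forces `F_{ri(R)-1}` to have codimension one.
    have h0 := h 0
    rw [affineHilbert_zero, sub_zero, affineHilbert] at h0
    have := Submodule.finrank_quotient_add_finrank (degFiltration I (regIndex I - 1))
    omega
  refine ⟨hq, fun j x hj hj' => ?_⟩
  obtain ⟨φ, hφ⟩ := exists_linearForm_of_finrank_quotient_eq_one hq
  have hnd' : ∀ x, x ≠ 0 → ∃ y, φ (x * y) ≠ 0 := fun x hx =>
    (hnd x hx).imp fun y hy => (hφ _).not.mpr hy
  let B : LinearMap.BilinForm K (MvPolynomial (Fin n) K ⧸ I) := (LinearMap.mul K _).compr₂ φ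
  have hBmem : ∀ z, z ∈ B.orthogonal (degFiltration I (regIndex I - j)) ↔
      ∀ y ∈ degFiltration I (regIndex I - j), φ (z * y) = 0 := by
    intro z
    rw [LinearMap.BilinForm.mem_orthogonal_iff]
    refine forall₂_congr fun y _ => ?_
    rw [mul_comm z]
    exact Iff.rfl
  have hle : degFiltration I (j - 1) ≤ B.orthogonal (degFiltration I (regIndex I - j)) := by
    intro z hz
    rw [hBmem]
    intro y hy
    rw [hφ, show regIndex I - 1 = (j - 1) + (regIndex I - j) by ring]
    exact mul_mem_degFiltration I hz hy
  have hdim := finrank_add_finrank_mul_orthogonal hnd' _ _ hBmem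
  have hsym := h (regIndex I - j)
  rw [show regIndex I - 1 - (regIndex I - j) = j - 1 by ring, affineHilbert, affineHilbert] at hsym
  have heq := Submodule.eq_of_le_of_finrank_eq hle (by omega)
  rw [heq, hBmem] at hj'
  push Not at hj'
  obtain ⟨y, hy, hxy⟩ := hj'
  exact ⟨y, hy, (hφ _).not.mp hxy⟩

end Artinian

end AffineAlgebra

end

/-! ### The associated graded ring and its socle. -/

noncomputable section

namespace AffineAlgebra

variable {K : Type*} [Field K] {n : ℕ} (I : Ideal (MvPolynomial (Fin n) K))

/-! ### Computations in the associated graded ring -/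

/-- Writing the degree as `j + k` avoids transport between components of equal degree. -/
theorem of_mul_apply_add (j k : ℤ) (ξ : GrPiece I j) (u : GrRing I) :
    (DirectSum.of (GrPiece I) j ξ * u) (j + k) = grMul I j k ξ (u k) := by
  induction u using DirectSum.induction_on with
  | zero => rw [mul_zero, DirectSum.zero_apply, DirectSum.zero_apply, map_zero]
  | add u v hu hv => rw [mul_add, DirectSum.add_apply, DirectSum.add_apply, map_add, hu, hv]
  | of l η =>
    rw [DirectSum.of_mul_of]
    by_cases h : k = l
    · subst h
      rw [DirectSum.of_eq_same, DirectSum.of_eq_same]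
      rfl
    · rw [DirectSum.of_eq_of_ne _ _ _ h, DirectSum.of_eq_of_ne _ _ _ (by omega), map_zero]

open scoped Classical in
theorem sum_of_eq (u : GrRing I) :
    ∑ i ∈ DFinsupp.support u, DirectSum.of (GrPiece I) i (u i) = u :=
  DirectSum.sum_support_of u

/-- All components of `u` of degree less than `k` vanish. -/
def VanishesBelow (k : ℤ) (u : GrRing I) : Prop := ∀ j < k, u j = 0

variable {I}

theorem VanishesBelow.mul {k l : ℤ} {u v : GrRing I} (hu : VanishesBelow I k u)
    (hv : VanishesBelow I l v) : VanishesBelow I (k + l) (u * v) := by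
  classical
  intro d hd
  rw [← sum_of_eq I u, Finset.sum_mul, DFinsupp.finsetSum_apply]
  refine Finset.sum_eq_zero fun i _ => ?_
  obtain ⟨e, rfl⟩ : ∃ e, d = i + e := ⟨d - i, by ring⟩
  rw [of_mul_apply_add]
  by_cases hi : i < k
  · rw [hu i hi, map_zero, LinearMap.zero_apply]
  · rw [hv e (by omega), map_zero]

theorem vanishesBelow_of {k j : ℤ} (hkj : k ≤ j) (ξ : GrPiece I j) :
    VanishesBelow I k (DirectSum.of (GrPiece I) j ξ) := fun i hi =>
  DirectSum.of_eq_of_ne _ _ _ (by omega)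

theorem grPiece_eq_zero_of_neg {j : ℤ} (hj : j < 0) (ξ : GrPiece I j) : ξ = 0 := by
  obtain ⟨f, rfl⟩ := GrPiece.mk_surjective I _ ξ
  rw [GrPiece.mk_eq_zero_iff]
  have h0 : f.1 = 0 := (Submodule.mem_bot K).mp ((degFiltration_eq_bot I hj).le f.2)
  rw [h0]
  exact Submodule.zero_mem _

theorem vanishesBelow_zero (u : GrRing I) : VanishesBelow I 0 u := fun _ hj =>
  grPiece_eq_zero_of_neg hj _

theorem vanishesBelow_one_iff {u : GrRing I} : VanishesBelow I 1 u ↔ u 0 = 0 := by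
  refine ⟨fun h => h 0 (by norm_num), fun h j hj => ?_⟩
  rcases lt_or_eq_of_le (show j ≤ 0 by omega) with h0 | rfl
  · exact grPiece_eq_zero_of_neg h0 _
  · exact h

theorem vanishesBelow_sub_of (u : GrRing I) :
    VanishesBelow I 1 (u - DirectSum.of (GrPiece I) 0 (u 0)) := by
  rw [vanishesBelow_one_iff, DirectSum.sub_apply, DirectSum.of_eq_same, sub_self]

theorem VanishesBelow.pow {u : GrRing I} (hu : VanishesBelow I 1 u) (k : ℕ) :
    VanishesBelow I k (u ^ k) := by
  induction k with
  | zero => exact vanishesBelow_zero _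
  | succ k ih =>
    rw [pow_succ, Nat.cast_succ]
    exact ih.mul hu

/-- The class of a constant in degree `0`. -/
theorem exists_eq_mk_algebraMap (ξ : GrPiece I 0) : ∃ c : K, ξ = GrPiece.mk I 0
    ⟨algebraMap K _ c, algebraMap_mem_degFiltration_zero I c⟩ := by
  obtain ⟨⟨f, hf⟩, rfl⟩ := GrPiece.mk_surjective I _ ξ
  obtain ⟨c, rfl⟩ := exists_eq_algebraMap_of_mem_degFiltration_zero hf
  exact ⟨c, rfl⟩

theorem of_mk_algebraMap_mul_of (c : K) (j : ℤ) (ξ : GrPiece I j) :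
    DirectSum.of (GrPiece I) 0 (GrPiece.mk I 0
      ⟨algebraMap K _ c, algebraMap_mem_degFiltration_zero I c⟩) *
      DirectSum.of (GrPiece I) j ξ = DirectSum.of (GrPiece I) j (c • ξ) := by
  obtain ⟨f, rfl⟩ := GrPiece.mk_surjective I _ ξ
  rw [DirectSum.of_mul_of, ← map_smul]
  refine DirectSum.of_eq_of_gradedMonoid_eq (gradedMk_eq I (zero_add j) ?_)
  exact (Algebra.smul_def c f.1).symm

theorem isUnit_of_of_ne_zero {ξ : GrPiece I 0} (hξ : ξ ≠ 0) :
    IsUnit (DirectSum.of (GrPiece I) 0 ξ) := by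
  obtain ⟨c, rfl⟩ := exists_eq_mk_algebraMap ξ
  have hc : c ≠ 0 := by
    rintro rfl
    refine hξ ((GrPiece.mk_eq_zero_iff I _).mpr ?_)
    simp
  refine IsUnit.of_mul_eq_one (DirectSum.of (GrPiece I) 0 (GrPiece.mk I 0
    ⟨algebraMap K _ c⁻¹, algebraMap_mem_degFiltration_zero I c⁻¹⟩)) ?_
  rw [of_mk_algebraMap_mul_of, ← map_smul]
  have : c • (⟨algebraMap K (MvPolynomial (Fin n) K ⧸ I) c⁻¹,
      algebraMap_mem_degFiltration_zero I c⁻¹⟩ : degFiltration I 0) =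
      ⟨1, one_mem_degFiltration I⟩ := by
    refine Subtype.ext ?_
    refine (Algebra.smul_def c (algebraMap K (MvPolynomial (Fin n) K ⧸ I) c⁻¹)).trans ?_
    rw [← map_mul, mul_inv_cancel₀ hc, map_one]
  rw [this]
  rfl

section Artinian

variable [Module.Finite K (MvPolynomial (Fin n) K ⧸ I)] [Nontrivial (MvPolynomial (Fin n) K ⧸ I)]

theorem grPiece_eq_zero_of_regIndex_lt {j : ℤ} (hj : regIndex I < j) (ξ : GrPiece I j) :
    ξ = 0 := by
  obtain ⟨f, rfl⟩ := GrPiece.mk_surjective I _ ξ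
  rw [GrPiece.mk_eq_zero_iff]
  exact mem_degFiltration_of_regIndex_le I (by omega) _

theorem eq_zero_of_vanishesBelow {k : ℤ} (hk : regIndex I < k) {u : GrRing I}
    (hu : VanishesBelow I k u) : u = 0 := by
  refine DFinsupp.ext fun j => ?_
  by_cases hj : j < k
  · exact hu j hj
  · exact grPiece_eq_zero_of_regIndex_lt (by omega) _

theorem eq_of_of_vanishesBelow_regIndex {u : GrRing I} (hu : VanishesBelow I (regIndex I) u) :
    u = DirectSum.of (GrPiece I) (regIndex I) (u (regIndex I)) := by
  refine DFinsupp.ext fun j => ?_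
  rcases lt_trichotomy j (regIndex I) with h | rfl | h
  · rw [hu j h]
    exact (DirectSum.of_eq_of_ne _ _ _ h.ne).symm
  · exact (DirectSum.of_eq_same _ _).symm
  · rw [grPiece_eq_zero_of_regIndex_lt h (u j)]
    exact (DirectSum.of_eq_of_ne _ _ _ h.ne').symm

theorem VanishesBelow.isNilpotent {u : GrRing I} (hu : VanishesBelow I 1 u) : IsNilpotent u :=
  -- The power with exponent `ri(R) + 1` starts above the top degree.
  ⟨(regIndex I).toNat + 1, eq_zero_of_vanishesBelow (by push_cast; omega) (hu.pow _)⟩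

/-- Such a `u` is a nonzero constant plus a nilpotent element. -/
theorem isUnit_of_apply_zero_ne_zero {u : GrRing I} (hu : u 0 ≠ 0) : IsUnit u := by
  have h := (vanishesBelow_sub_of u).isNilpotent
  have h' := isUnit_of_of_ne_zero hu
  rw [← sub_add_cancel u (DirectSum.of (GrPiece I) 0 (u 0))]
  exact h.isUnit_add_right_of_commute h' (Commute.all _ _)

instance grRing_nontrivial : Nontrivial (GrRing I) := by
  obtain ⟨w, hw⟩ := exists_notMem_degFiltration I
  refine ⟨⟨DirectSum.of (GrPiece I) (regIndex I)
    (GrPiece.mk I _ ⟨w, mem_degFiltration_of_regIndex_le I le_rfl w⟩), 0, fun h => hw ?_⟩⟩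
  have := congrArg (fun u : GrRing I => u (regIndex I)) h
  simp only [DirectSum.of_eq_same, DirectSum.zero_apply] at this
  exact (GrPiece.mk_eq_zero_iff I _).mp this

theorem isUnit_iff_apply_zero_ne_zero {u : GrRing I} : IsUnit u ↔ u 0 ≠ 0 := by
  refine ⟨fun h h0 => ?_, isUnit_of_apply_zero_ne_zero⟩
  exact (vanishesBelow_one_iff.mpr h0).isNilpotent.not_isUnit h

/-- The associated graded ring is a local ring. -/
theorem isLocalRing_grRing : IsLocalRing (GrRing I) := by
  refine IsLocalRing.of_nonunits_add fun u v hu hv => ?_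
  rw [mem_nonunits_iff, isUnit_iff_apply_zero_ne_zero, not_not] at hu hv ⊢
  rw [DirectSum.add_apply, hu, hv, add_zero]

theorem mem_maximalIdeal_grRing_iff [IsLocalRing (GrRing I)] {u : GrRing I} :
    u ∈ IsLocalRing.maximalIdeal (GrRing I) ↔ VanishesBelow I 1 u := by
  rw [IsLocalRing.mem_maximalIdeal, mem_nonunits_iff, isUnit_iff_apply_zero_ne_zero, not_not,
    vanishesBelow_one_iff]

/-- The top component lies in the socle. -/
theorem mul_of_regIndex_eq_zero {u : GrRing I} (hu : VanishesBelow I 1 u)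
    (ξ : GrPiece I (regIndex I)) : u * DirectSum.of (GrPiece I) (regIndex I) ξ = 0 :=
  eq_zero_of_vanishesBelow (by omega) (hu.mul (vanishesBelow_of le_rfl ξ))

theorem exists_mul_of_regIndex_eq (u : GrRing I) (ξ : GrPiece I (regIndex I)) :
    ∃ c : K, u * DirectSum.of (GrPiece I) (regIndex I) ξ =
      DirectSum.of (GrPiece I) (regIndex I) (c • ξ) := by
  obtain ⟨c, hc⟩ := exists_eq_mk_algebraMap (u 0)
  refine ⟨c, ?_⟩
  rw [← sub_add_cancel u (DirectSum.of (GrPiece I) 0 (u 0)), add_mul,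
    mul_of_regIndex_eq_zero (vanishesBelow_sub_of u), zero_add, hc, of_mk_algebraMap_mul_of]

/-! ### Strict Gorenstein rings and the pairing on the associated graded ring -/

theorem HasPerfectGradedPairing.isStrictGorenstein (h : HasPerfectGradedPairing I) :
    IsStrictGorenstein I := by
  have := isLocalRing_grRing (I := I)
  obtain ⟨w, hw⟩ := exists_notMem_degFiltration I
  set ω : GrPiece I (regIndex I) :=
    GrPiece.mk I _ ⟨w, mem_degFiltration_of_regIndex_le I le_rfl w⟩ with hω
  have hω0 : ω ≠ 0 := fun h => hw ((GrPiece.mk_eq_zero_iff I _).mp h)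
  refine isZeroDimLocalGorenstein_of_forall_eq_mul
    (s := DirectSum.of (GrPiece I) (regIndex I) ω) ?_ ?_ ?_
  · intro h
    have := congrArg (fun u : GrRing I => u (regIndex I)) h
    simp only [DirectSum.of_eq_same, DirectSum.zero_apply] at this
    exact hω0 this
  · intro a ha
    exact mul_of_regIndex_eq_zero (mem_maximalIdeal_grRing_iff.mp ha) ω
  · intro u hu
    -- A nonzero component in degree `j < ri(R)` has a partner of positive degree `ri(R) - j`, which
    -- lies in the maximal ideal and does not kill `u`.
    have hvan : VanishesBelow I (regIndex I) u := by
      intro j hj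
      obtain ⟨⟨f, hf⟩, hfu⟩ := GrPiece.mk_surjective I _ (u j)
      rw [← hfu, GrPiece.mk_eq_zero_iff]
      by_contra hf'
      obtain ⟨y, hy, hfy⟩ := h.exists_mul_notMem j f hf hf'
      have h0 := hu (DirectSum.of (GrPiece I) (regIndex I - j) (GrPiece.mk I _ ⟨y, hy⟩))
        (mem_maximalIdeal_grRing_iff.mpr (vanishesBelow_of (by omega) _))
      have h1 := of_mul_apply_add I (regIndex I - j) j (GrPiece.mk I _ ⟨y, hy⟩) u
      rw [h0, DirectSum.zero_apply, ← hfu, grMul_mk, eq_comm, GrPiece.mk_eq_zero_iff] at h1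
      refine hfy ?_
      rw [mul_comm]
      exact degFiltration_mono I (by omega) h1
    obtain ⟨⟨z, hz⟩, hzu⟩ := GrPiece.mk_surjective I _ (u (regIndex I))
    have hw' : (degFiltration I (regIndex I - 1)).mkQ w ≠ 0 := by
      rwa [Submodule.mkQ_apply, Ne, Submodule.Quotient.mk_eq_zero]
    obtain ⟨c, hc⟩ := (finrank_eq_one_iff_of_nonzero' _ hw').mp h.finrank_quotient
      ((degFiltration I (regIndex I - 1)).mkQ z)
    refine ⟨DirectSum.of (GrPiece I) 0 (GrPiece.mk I 0
      ⟨algebraMap K _ c, algebraMap_mem_degFiltration_zero I c⟩), ?_⟩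
    rw [of_mk_algebraMap_mul_of, eq_of_of_vanishesBelow_regIndex hvan, ← hzu, hω, ← map_smul]
    congr 1
    rw [← sub_eq_zero, ← map_sub, GrPiece.mk_eq_zero_iff]
    rw [← map_smul, eq_comm, ← sub_eq_zero, ← map_sub, Submodule.mkQ_apply,
      Submodule.Quotient.mk_eq_zero] at hc
    exact hc

/-- The nonzero top class `ω` lies in the socle, so the socle is the line `K ω`. Hence a nonzero
homogeneous element below the top degree is not killed by the maximal ideal and can be moved up
until it reaches the top. -/
theorem IsStrictGorenstein.hasPerfectGradedPairing (h : IsStrictGorenstein I) :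
    HasPerfectGradedPairing I := by
  classical
  obtain ⟨hloc, hsoc⟩ := h
  obtain ⟨w, hw⟩ := exists_notMem_degFiltration I
  set ω : GrPiece I (regIndex I) :=
    GrPiece.mk I _ ⟨w, mem_degFiltration_of_regIndex_le I le_rfl w⟩ with hω
  have hω0 : DirectSum.of (GrPiece I) (regIndex I) ω ≠ 0 := by
    intro h
    have := congrArg (fun u : GrRing I => u (regIndex I)) h
    simp only [DirectSum.of_eq_same, DirectSum.zero_apply] at this
    exact hw ((GrPiece.mk_eq_zero_iff I _).mp this)
  have hgen : ∀ u : GrRing I, (∀ a, VanishesBelow I 1 a → a * u = 0) →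
      ∃ c : K, u = DirectSum.of (GrPiece I) (regIndex I) (c • ω) := by
    intro u hu
    obtain ⟨a, rfl⟩ := eq_mul_of_finrank_socle_eq_one hsoc hω0
      (fun a ha => mul_of_regIndex_eq_zero (mem_maximalIdeal_grRing_iff.mp ha) ω)
      fun a ha => hu a (mem_maximalIdeal_grRing_iff.mp ha)
    exact exists_mul_of_regIndex_eq a ω
  refine ⟨?_, ?_⟩
  · refine finrank_eq_one ((degFiltration I (regIndex I - 1)).mkQ w) ?_ fun z => ?_
    · rwa [Submodule.mkQ_apply, Ne, Submodule.Quotient.mk_eq_zero]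
    obtain ⟨z, rfl⟩ := Submodule.mkQ_surjective _ z
    obtain ⟨c, hc⟩ := hgen (DirectSum.of (GrPiece I) (regIndex I)
      (GrPiece.mk I _ ⟨z, mem_degFiltration_of_regIndex_le I le_rfl z⟩))
      fun a ha => mul_of_regIndex_eq_zero ha _
    refine ⟨c, ?_⟩
    have hc' := DirectSum.of_injective _ hc
    rw [hω, ← map_smul, ← sub_eq_zero, ← map_sub, GrPiece.mk_eq_zero_iff] at hc'
    rw [← map_smul, eq_comm, ← sub_eq_zero, ← map_sub, Submodule.mkQ_apply,
      Submodule.Quotient.mk_eq_zero]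
    exact hc'
  · have key : ∀ (d : ℕ) (j : ℤ), regIndex I - j ≤ d → ∀ x ∈ degFiltration I j,
        x ∉ degFiltration I (j - 1) → ∃ y ∈ degFiltration I (regIndex I - j),
          x * y ∉ degFiltration I (regIndex I - 1) := by
      intro d
      induction d with
      | zero =>
        intro j hj x hx hx'
        have : j ≤ regIndex I := by
          by_contra! hlt
          exact hx' (mem_degFiltration_of_regIndex_le I (by omega) x)
        obtain rfl : j = regIndex I := by push_cast at hj; omega
        refine ⟨1, ?_, ?_⟩
        · rw [sub_self]
          exact one_mem_degFiltration I
        · rwa [mul_one]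
      | succ d ih =>
        intro j hj x hx hx'
        by_cases hjd : regIndex I - j ≤ d
        · exact ih j hjd x hx hx'
        have hne : DirectSum.of (GrPiece I) j (GrPiece.mk I j ⟨x, hx⟩) ≠ 0 := by
          intro h
          have := congrArg (fun u : GrRing I => u j) h
          simp only [DirectSum.of_eq_same, DirectSum.zero_apply] at this
          exact hx' ((GrPiece.mk_eq_zero_iff I _).mp this)
        have hex : ∃ a, VanishesBelow I 1 a ∧
            a * DirectSum.of (GrPiece I) j (GrPiece.mk I j ⟨x, hx⟩) ≠ 0 := by
          by_contra! hall
          obtain ⟨c, hc⟩ := hgen _ hall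
          have := congrArg (fun u : GrRing I => u j) hc
          simp only [DirectSum.of_eq_same] at this
          rw [DirectSum.of_eq_of_ne _ _ _ (by omega)] at this
          exact hx' ((GrPiece.mk_eq_zero_iff I _).mp this)
        obtain ⟨a, ha, hax⟩ := hex
        -- Some homogeneous component of `a`, of degree `k ≥ 1`, already fails to kill the class of
        -- `x`.
        rw [← sum_of_eq I a, Finset.sum_mul] at hax
        obtain ⟨k, -, hk⟩ := Finset.exists_ne_zero_of_sum_ne_zero hax
        have hk1 : 1 ≤ k := by
          by_contra! hlt
          rw [ha k hlt, map_zero, zero_mul] at hk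
          exact hk rfl
        obtain ⟨⟨t, ht⟩, hta⟩ := GrPiece.mk_surjective I _ (a k)
        have htx : t * x ∉ degFiltration I (k + j - 1) := by
          intro hmem
          refine hk ?_
          rw [← hta, DirectSum.of_mul_of]
          have : GradedMonoid.GMul.mul (GrPiece.mk I k ⟨t, ht⟩) (GrPiece.mk I j ⟨x, hx⟩) =
              (0 : GrPiece I (k + j)) := (GrPiece.mk_eq_zero_iff I _).mpr hmem
          rw [this, map_zero]
        obtain ⟨y, hy, hxy⟩ := ih (k + j) (by push_cast at hj; omega) (t * x)
          (mul_mem_degFiltration I ht hx) htx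
        -- A partner `y` of `t x` yields the partner `t y` of `x`.
        refine ⟨t * y, ?_, ?_⟩
        · rw [show regIndex I - j = k + (regIndex I - (k + j)) by ring]
          exact mul_mem_degFiltration I ht hy
        · rwa [mul_left_comm, ← mul_assoc]
    intro j x hx hx'
    exact key (regIndex I - j).toNat j (Int.self_le_toNat _) x hx hx'

theorem isStrictGorenstein_iff_hasPerfectGradedPairing :
    IsStrictGorenstein I ↔ HasPerfectGradedPairing I :=
  ⟨fun h => h.hasPerfectGradedPairing, fun h => h.isStrictGorenstein⟩

end Artinian

end AffineAlgebra

end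

/-! ### Minimal divisors, the Cayley-Bacharach property, local Gorenstein rings. -/

noncomputable section

namespace AffineAlgebra

variable {K : Type*} [Field K] {n : ℕ} {I : Ideal (MvPolynomial (Fin n) K)}

/-! ### Minimal divisors -/

open scoped Classical in
/-- The principal ideal generated by an element of the other primary components that is
multiplied into `I` exactly by the radical of `Q` yields a minimal `Q`-divisor. -/
theorem isMinimalDivisor_sup_span_singleton {t : Finset (Ideal (MvPolynomial (Fin n) K))}
    (ht : Submodule.IsMinimalPrimaryDecomposition I t) {Q : Ideal (MvPolynomial (Fin n) K)}
    (hQ : Q ∈ t) {y : MvPolynomial (Fin n) K} (hy : y ∈ (t.erase Q).inf id) (hyI : y ∉ I)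
    (hyM : ∀ a, a ∈ Q.radical ↔ a * y ∈ I) :
    IsMinimalDivisor I t Q (I ⊔ Ideal.span {y}) := by
  refine ⟨⟨Q ⊔ Ideal.span {y}, ?_, ?_⟩, finrank_map_sup_span_singleton hyM⟩
  · refine lt_of_le_of_ne le_sup_left fun h => hyI ?_
    rw [← inf_erase_inf_eq ht hQ]
    refine ⟨?_, hy⟩
    rw [h]
    exact Ideal.mem_sup_right (Ideal.mem_span_singleton_self y)
  · have hle : Ideal.span {y} ≤ (t.erase Q).inf id := by
      rwa [Ideal.span_singleton_le_iff_mem]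
    -- Modular law, as `y` lies in all the other components.
    rw [sup_comm Q, sup_inf_assoc_of_le _ hle, inf_erase_inf_eq ht hQ, sup_comm]

variable [Module.Finite K (MvPolynomial (Fin n) K ⧸ I)]

theorem isMaximal_of_isPrime_of_le {p : Ideal (MvPolynomial (Fin n) K)} (hp : p.IsPrime)
    (hIp : I ≤ p) : p.IsMaximal := by
  have : IsArtinianRing (MvPolynomial (Fin n) K ⧸ I) := IsArtinianRing.of_finite K _
  have hker : RingHom.ker (Ideal.Quotient.mk I) ≤ p := by rwa [Ideal.mk_ker]
  have hp' : (p.map (Ideal.Quotient.mk I)).IsPrime :=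
    Ideal.map_isPrime_of_surjective Ideal.Quotient.mk_surjective hker
  have := Ideal.comap_isMaximal_of_surjective (Ideal.Quotient.mk I)
    Ideal.Quotient.mk_surjective (K := p.map (Ideal.Quotient.mk I))
  rwa [Ideal.comap_map_of_surjective' _ Ideal.Quotient.mk_surjective, sup_eq_left.mpr hker] at this

theorem map_ne_bot_of_isMinimalDivisor {t : Finset (Ideal (MvPolynomial (Fin n) K))}
    (ht : Submodule.IsMinimalPrimaryDecomposition I t) {Q J : Ideal (MvPolynomial (Fin n) K)}
    (hQ : Q ∈ t) (hJ : IsMinimalDivisor I t Q J) : J.map (Ideal.Quotient.mk I) ≠ ⊥ := by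
  intro h
  have hdim := hJ.2
  have hle : I ≤ Q.radical := (le_of_mem_decomposition ht hQ).trans Ideal.le_radical
  have : Module.Finite K (MvPolynomial (Fin n) K ⧸ Q.radical) :=
    Module.Finite.of_surjective (Ideal.Quotient.factorₐ K hle).toLinearMap
      (Ideal.Quotient.factor_surjective hle)
  have : Nontrivial (MvPolynomial (Fin n) K ⧸ Q.radical) :=
    Ideal.Quotient.nontrivial_iff.mpr (radical_isPrime_of_mem_decomposition ht hQ).ne_top
  have hpos : 0 < Module.finrank K (MvPolynomial (Fin n) K ⧸ Q.radical) := Module.finrank_pos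
  have h0 : Module.finrank K (J.map (Ideal.Quotient.mk I)) = 0 := by
    have : Subsingleton (J.map (Ideal.Quotient.mk I)) := by
      rw [h]
      infer_instance
    exact Module.finrank_zero_of_subsingleton
  omega

/-! ### The Cayley-Bacharach property -/

variable [Nontrivial (MvPolynomial (Fin n) K ⧸ I)]

/-- Every nonzero ideal of `R` contains an element of order `ri(R)`, so all minimal divisors give
the value `ri(R)`. A separator shows that one exists; otherwise the infimum would default to `0`. -/
theorem HasPerfectGradedPairing.hasCBP (h : HasPerfectGradedPairing I) : HasCBP I := by
  classical
  intro t ht Q hQ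
  have hall : ∀ J, IsMinimalDivisor I t Q J →
      idealRegIndex I (J.map (Ideal.Quotient.mk I)) = regIndex I := by
    intro J hJ
    obtain ⟨x, hxJ, hx⟩ :=
      Submodule.exists_mem_ne_zero_of_ne_bot (map_ne_bot_of_isMinimalDivisor ht hQ hJ)
    obtain ⟨y, hy⟩ := h.exists_mul_notMem_of_ne_zero hx
    exact idealRegIndex_eq_regIndex (Ideal.mul_mem_right y _ hxJ) hy
  obtain ⟨y, hy, hyQ, hyM⟩ := exists_separator ht hQ
  have hyM' : ∀ a, a ∈ Q.radical ↔ a * y ∈ I := by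
    refine fun a => ⟨hyM a, fun ha => ?_⟩
    have ha' := le_of_mem_decomposition ht hQ ha
    rw [mul_comm] at ha'
    exact ((Ideal.isPrimary_iff.mp (ht.primary hQ)).2 ha').resolve_left hyQ
  have hdiv := isMinimalDivisor_sup_span_singleton ht hQ hy
    (fun hyI => hyQ (le_of_mem_decomposition ht hQ hyI)) hyM'
  have hset : {k : ℤ | ∃ J, IsMinimalDivisor I t Q J ∧
      k = idealRegIndex I (J.map (Ideal.Quotient.mk I))} = {regIndex I} := by
    ext k
    refine ⟨?_, fun hk => ⟨_, hdiv, ?_⟩⟩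
    · rintro ⟨J, hJ, rfl⟩
      exact hall J hJ
    · rw [hall _ hdiv]
      exact hk
  rw [sepDegree, hset, csInf_singleton]

/-- If all multiples of `x` lay in `F_{ri(R)-1}`, a multiple of `x` whose annihilator is maximal
would generate a minimal divisor of index below `ri(R)`, against CBP. -/
theorem HasCBP.exists_mul_notMem (h : HasCBP I) {x : MvPolynomial (Fin n) K ⧸ I} (hx : x ≠ 0) :
    ∃ y, x * y ∉ degFiltration I (regIndex I - 1) := by
  classical
  obtain ⟨p, rfl⟩ := Ideal.Quotient.mk_surjective x
  rw [Ne, Ideal.Quotient.eq_zero_iff_mem] at hx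
  obtain ⟨c, hcp, M, hMp, hM⟩ := exists_mul_colon_isPrime hx
  have hMmax : M.IsMaximal := isMaximal_of_isPrime_of_le hMp fun a ha =>
    (hM a).mpr (I.mul_mem_right _ ha)
  obtain ⟨t, ht⟩ := Submodule.IsLasker.exists_isMinimalPrimaryDecomposition
    (Submodule.isLasker (MvPolynomial (Fin n) K) (MvPolynomial (Fin n) K)) I
  obtain ⟨Q, hQ, rfl, hothers⟩ :=
    exists_component_of_annihilated_by_maximal ht hMmax hcp fun a ha => (hM a).mp ha
  have hmem : c * p ∈ (t.erase Q).inf id := by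
    rw [Submodule.mem_finsetInf]
    intro Q' hQ'
    exact hothers Q' (Finset.mem_of_mem_erase hQ') (Finset.ne_of_mem_erase hQ')
  have hdiv := isMinimalDivisor_sup_span_singleton ht hQ hmem hcp hM
  by_contra! hall
  have hlt := idealRegIndex_lt_regIndex (map_ne_bot_of_isMinimalDivisor ht hQ hdiv) (by
    intro z hz
    obtain ⟨q, hq, rfl⟩ :=
      (Ideal.mem_map_iff_of_surjective _ Ideal.Quotient.mk_surjective).mp hz
    obtain ⟨i, hi, w, hw, rfl⟩ := Submodule.mem_sup.mp hq
    obtain ⟨d, rfl⟩ := Ideal.mem_span_singleton'.mp hw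
    have := hall (Ideal.Quotient.mk I (d * c))
    rw [map_add, Ideal.Quotient.eq_zero_iff_mem.mpr hi, zero_add, ← mul_assoc, map_mul,
      mul_comm]
    exact this)
  have hle : sepDegree I t Q ≤ _ := csInf_le ⟨0, by
    rintro k ⟨J, hJ, rfl⟩
    exact idealRegIndex_nonneg (map_ne_bot_of_isMinimalDivisor ht hQ hJ)⟩ ⟨_, hdiv, rfl⟩
  rw [h t ht Q hQ] at hle
  omega

/-! ### Nondegenerate linear forms and local Gorenstein rings -/

/-- A finite-dimensional commutative algebra with a linear form `φ` such that `(x, y) ↦ φ(x y)` is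
nondegenerate is locally Gorenstein. -/
theorem isLocallyGorenstein_of_linearForm {R : Type*} [CommRing R] [Algebra K R]
    [Module.Finite K R] {φ : R →ₗ[K] K} (hφ : ∀ x, x ≠ 0 → ∃ y, φ (x * y) ≠ 0) :
    IsLocallyGorenstein R := by
  classical
  have : IsArtinianRing R := IsArtinianRing.of_finite K R
  intro t ht q hq
  have hmax : ∀ p : Ideal R, p.IsPrime → ⊥ ≤ p → p.IsMaximal := fun p _ _ => inferInstance
  have hqm : q.radical.IsMaximal :=
    hmax _ (radical_isPrime_of_mem_decomposition ht hq) bot_le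
  have := isLocalRing_quotient_of_radical_isMaximal hqm
  obtain ⟨s, hsN, hsq, hs⟩ := exists_separator ht hq
  simp only [Ideal.mem_bot] at hs
  have hs0 : s ≠ 0 := fun h => hsq (h ▸ q.zero_mem)
  have hsM : ∀ a, a ∈ q.radical ↔ a * s ∈ (⊥ : Ideal R) := by
    refine fun a => ⟨hs a, fun ha => ?_⟩
    have ha' := le_of_mem_decomposition ht hq ha
    rw [mul_comm] at ha'
    exact ((Ideal.isPrimary_iff.mp (ht.primary hq)).2 ha').resolve_left hsq
  let S : Submodule K R := (Submodule.torsionBySet R R (q.radical : Set R)).restrictScalars K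
  have hS : ∀ x, x ∈ S ↔ ∀ a ∈ q.radical, a * x = 0 := fun x => by
    rw [Submodule.restrictScalars_mem, Submodule.mem_torsionBySet_iff, SetCoe.forall]
    rfl
  -- The annihilator `S` of the maximal ideal is its orthogonal space, by nondegeneracy.
  have hdim := finrank_add_finrank_mul_orthogonal hφ (q.radical.restrictScalars K) S (by
    intro x
    rw [hS]
    refine ⟨fun h y hy => by rw [mul_comm, h y hy, map_zero], fun h a ha => ?_⟩
    by_contra hne
    obtain ⟨y, hy⟩ := hφ _ hne
    refine hy ?_
    rw [show a * x * y = x * (a * y) by ring]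
    exact h _ (q.radical.mul_mem_right y ha))
  let f : R →ₗ[K] R := LinearMap.mulRight K s
  have hker : LinearMap.ker f = q.radical.restrictScalars K := by
    ext a
    rw [LinearMap.mem_ker, Submodule.restrictScalars_mem, hsM, Ideal.mem_bot]
    rfl
  have hrank := LinearMap.finrank_range_add_finrank_ker f
  rw [hker] at hrank
  -- `R s ⊆ S`, and both have dimension `dim R - dim q.radical`.
  have hrangeS : LinearMap.range f = S := by
    refine Submodule.eq_of_le_of_finrank_eq ?_ (by omega)
    rintro _ ⟨c, rfl⟩
    rw [hS]
    intro a ha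
    change a * (c * s) = 0
    rw [mul_left_comm, hs a ha, mul_zero]
  refine isZeroDimLocalGorenstein_of_forall_eq_mul (s := Ideal.Quotient.mk q s) ?_ ?_ ?_
  · rwa [Ne, Ideal.Quotient.eq_zero_iff_mem]
  · intro a ha
    obtain ⟨a, rfl⟩ := Ideal.Quotient.mk_surjective a
    rw [← map_mul, hs a (mem_radical_of_mk_mem_maximalIdeal hqm ha), map_zero]
  · intro x hx
    obtain ⟨x, rfl⟩ := Ideal.Quotient.mk_surjective x
    -- The element `e` is `1` modulo `q` and lies in the other components, so multiplying by it
    -- lifts socle elements of `R/q` into `S`.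
    obtain ⟨b, hb, e, he, hbe⟩ := Submodule.mem_sup.mp
      ((Ideal.eq_top_iff_one _).mp (sup_inf_erase_eq_top hmax ht hq))
    have hex : e * x ∈ S := by
      rw [hS]
      intro a ha
      have hax := hx _ (mk_mem_maximalIdeal_quotient ha)
      rw [← map_mul, Ideal.Quotient.eq_zero_iff_mem] at hax
      rw [← Ideal.mem_bot, ← inf_erase_inf_eq ht hq, mul_left_comm]
      exact ⟨q.mul_mem_left e hax, Ideal.mul_mem_right _ _ he⟩
    rw [← hrangeS] at hex
    obtain ⟨c, hc⟩ := hex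
    refine ⟨Ideal.Quotient.mk q c, ?_⟩
    rw [← map_mul, Ideal.Quotient.mk_eq_mk_iff_sub_mem]
    have hc' : c * s = e * x := hc
    rw [hc', show x - e * x = b * x by linear_combination (-x) * hbe]
    exact q.mul_mem_right x hb

end AffineAlgebra

end

/-! ### The characterization of strict Gorenstein rings. -/

theorem theorem6p7 {K : Type*} [Field K] {n : ℕ} (I : Ideal (MvPolynomial (Fin n) K))
    (hI : ringKrullDim (MvPolynomial (Fin n) K ⧸ I) = 0) :
    (AffineAlgebra.IsStrictGorenstein I ↔
      AffineAlgebra.HasCBP I ∧ AffineAlgebra.HasSymmetricAffineHilbert I) ∧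
    (AffineAlgebra.IsStrictGorenstein I →
      AffineAlgebra.IsLocallyGorenstein (MvPolynomial (Fin n) K ⧸ I)) := by
  have : Nontrivial (MvPolynomial (Fin n) K ⧸ I) := by
    rw [← not_subsingleton_iff_nontrivial]
    intro h
    rw [ringKrullDim_eq_bot_of_subsingleton] at hI
    exact absurd hI (by simp)
  have : Ring.KrullDimLE 0 (MvPolynomial (Fin n) K ⧸ I) := by
    rw [Ring.KrullDimLE, Order.krullDimLE_iff]
    exact hI.le
  have : Module.Finite K (MvPolynomial (Fin n) K ⧸ I) :=
    (Module.finite_iff_krullDimLE_zero K _).mpr this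
  rw [AffineAlgebra.isStrictGorenstein_iff_hasPerfectGradedPairing]
  refine ⟨⟨fun h => ⟨h.hasCBP, h.hasSymmetricAffineHilbert⟩, fun ⟨h, h'⟩ =>
    h'.hasPerfectGradedPairing fun x hx => h.exists_mul_notMem hx⟩, fun h => ?_⟩
  obtain ⟨φ, hφ⟩ := AffineAlgebra.exists_linearForm_of_finrank_quotient_eq_one h.finrank_quotient
  exact AffineAlgebra.isLocallyGorenstein_of_linearForm fun x hx =>
    (h.exists_mul_notMem_of_ne_zero hx).imp fun y hy => (hφ _).not.mpr hy
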